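/- Let $n,k\ge 0$ be integers. Let $D^k$ be the group of $k$-jets at the origin of $C^k$ diffeomorphisms of $\mathbb R^n$ (or germs thereof) fixing the origin, and for a smooth $n$-manifold $M$ (without boundary) let $P^k(M)$ be its $k$-th order frame bundle, i.e. the space of $k$-jets at $0$ of local $C^k$ diffeomorphisms $\mathbb R^n\to M$, with the right action of $D^k$ by composition. A geometric structure of order $k$ on $M$ is a continuous $D^k$-equivariant map $\omega:P^k(M)\to V$, where $V$ is a space with a $D^k$-action; its type is the pair $(k,V)$. In the following, $V$ is any Hausdorff space with a $D^k$-action, for instance a manifold. A $C^k$ diffeomorphism $f:N\to M$ induces $f^k:P^k(N)\to P^k(M)$; the pullback of $\omega$ is $\omega\circ f^k$, and a group acting on $M$ by $C^k$ diffeomorphisms preserves $\omega$ if $\omega\circ\gamma^k=\omega$ for each of its elements $\gamma$. Let $M$ be a compact smooth $n$-manifold with an action of a countable group $\Gamma$, and let $N$ be a smooth $n$-manifold with an action of a group $\Gamma'$. A $C^k$ orbit equivalence from $(N,\Gamma')$ to $(M,\Gamma)$ is a $C^k$ diffeomorphism $f:N\to M$ (a homeomorphism if $k=0$) such that $x,y\in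 N$ lie in the same $\Gamma'$-orbit if and only if $f(x),f(y)$ lie in the same $\Gamma$-orbit; it is called smooth if $f$ is a $C^\infty$ diffeomorphism. (1) Suppose that $\Gamma$ and $\Gamma'$ act by $C^k$ diffeomorphisms, that $\Gamma$ preserves a geometric structure $\omega:P^k(M)\to V$ of order $k$, and that $f:N\to M$ is a $C^k$ orbit equivalence. Then the pullback $\omega\circ f^k:P^k(N)\to V$ is a geometric structure on $N$ (of the same type as $\omega$), and $\Gamma'$ preserves it. (2) Suppose that $\Gamma$ and $\Gamma'$ act by $C^\infty$ diffeomorphisms and that $f:N\to M$ is a smooth orbit equivalence. If $\Gamma$ preserves a volume form $\omega$ on $M$ (a smooth nowhere vanishing $n$-form), then $f^*\omega$ is a volume form on $N$ preserved by $\Gamma'$. If $\Gamma$ preserves a symplectic form $\omega$ on $M$ (a smooth closed nondegenerate $2$-form), then $f^*\omega$ is a symplectic form on $N$ preserved by $\Gamma'$. -/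

import Mathlib

open scoped Manifold ContDiff Topology

attribute [local instance] chartedSpaceSelf

noncomputable section

/-! ### Jets of maps of Euclidean space -/

/-- Two maps of `ℝⁿ` have the same `k`-jet at the origin. -/
def SameJet {n : ℕ} (k : ℕ) (f g : EuclideanSpace ℝ (Fin n) → EuclideanSpace ℝ (Fin n)) : Prop :=
  ∀ i ≤ k, iteratedFDeriv ℝ i f 0 = iteratedFDeriv ℝ i g 0

namespace SameJet

variable {n k : ℕ} {f f' g g' : EuclideanSpace ℝ (Fin n) → EuclideanSpace ℝ (Fin n)}

theorem refl (f : EuclideanSpace ℝ (Fin n) → EuclideanSpace ℝ (Fin n)) : SameJet k f f :=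
  fun _ _ => rfl

theorem symm (h : SameJet k f g) : SameJet k g f := fun i hi => (h i hi).symm

theorem trans (h : SameJet k f g) (h' : SameJet k g f') : SameJet k f f' :=
  fun i hi => (h i hi).trans (h' i hi)

theorem of_eventuallyEq (h : f =ᶠ[𝓝 0] g) : SameJet k f g :=
  fun i _ => (h.iteratedFDeriv ℝ i).eq_of_nhds

theorem apply_zero (h : SameJet k f g) : f 0 = g 0 := by
  have := congrArg (fun m => m (fun j => Fin.elim0 j)) (h 0 (Nat.zero_le k))
  simpa using this

/-- The `k`-jet of a composition depends only on the `k`-jet of the inner map. -/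
theorem comp_left (hF : ContDiffAt ℝ k f (g 0)) (hg : ContDiffAt ℝ k g 0)
    (hg' : ContDiffAt ℝ k g' 0) (h : SameJet k g g') : SameJet k (f ∘ g) (f ∘ g') := by
  intro i hi
  have hi' : (i : ℕ∞ω) ≤ (k : ℕ∞ω) := by exact_mod_cast hi
  rw [iteratedFDeriv_comp hF hg hi', iteratedFDeriv_comp (h.apply_zero ▸ hF) hg' hi',
    ← h.apply_zero]
  simp only [FormalMultilinearSeries.taylorComp]
  refine Finset.sum_congr rfl fun c _ => ?_
  refine ContinuousMultilinearMap.ext fun v => ?_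
  have e : ∀ m, iteratedFDeriv ℝ (c.partSize m) g 0 = iteratedFDeriv ℝ (c.partSize m) g' 0 :=
    fun m => h _ ((c.partSize_le m).trans hi)
  simp only [FormalMultilinearSeries.compAlongOrderedFinpartition_apply, ftaylorSeries, e]

/-- The `k`-jet of a composition depends only on the `k`-jet of the outer map. -/
theorem comp_right (hf : ContDiffAt ℝ k f 0) (hf' : ContDiffAt ℝ k f' 0)
    (hg : ContDiffAt ℝ k g 0) (hg0 : g 0 = 0) (h : SameJet k f f') :
    SameJet k (f ∘ g) (f' ∘ g) := by
  intro i hi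
  have hi' : (i : ℕ∞ω) ≤ (k : ℕ∞ω) := by exact_mod_cast hi
  rw [iteratedFDeriv_comp (by rwa [hg0]) hg hi', iteratedFDeriv_comp (by rwa [hg0]) hg hi', hg0]
  simp only [FormalMultilinearSeries.taylorComp]
  refine Finset.sum_congr rfl fun c _ => ?_
  ext v
  simp only [FormalMultilinearSeries.compAlongOrderedFinpartition_apply, ftaylorSeries]
  rw [h _ (c.length_le.trans hi)]

end SameJet

/-! ### The jet group `Dᵏ` -/

/-- Representatives of germs at the origin of `Cᵏ` diffeomorphisms of `ℝⁿ` fixing the origin. Every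
jet of such a germ is also the jet of a globally defined diffeomorphism of `ℝⁿ`, so that using germs
does not change the group of jets. -/
structure DiffeoAtOrigin (n k : ℕ) where
  toFun : EuclideanSpace ℝ (Fin n) → EuclideanSpace ℝ (Fin n)
  isLocalDiffeo : IsLocalDiffeomorphAt (𝓡 n) (𝓡 n) k toFun 0
  map_zero : toFun 0 = 0

namespace DiffeoAtOrigin

variable {n k : ℕ}

theorem contDiffAt (g : DiffeoAtOrigin n k) : ContDiffAt ℝ k g.toFun 0 :=
  g.isLocalDiffeo.contMDiffAt.contDiffAt

instance jetSetoid (n k : ℕ) : Setoid (DiffeoAtOrigin n k) where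
  r g h := SameJet k g.toFun h.toFun
  iseqv := ⟨fun g => SameJet.refl g.toFun, SameJet.symm, SameJet.trans⟩

/-- The identity. -/
def one (n k : ℕ) : DiffeoAtOrigin n k :=
  ⟨id, (Diffeomorph.refl (𝓡 n) (EuclideanSpace ℝ (Fin n)) k).isLocalDiffeomorph 0, rfl⟩

/-- Composition. -/
def comp (g h : DiffeoAtOrigin n k) : DiffeoAtOrigin n k :=
  ⟨g.toFun ∘ h.toFun, h.isLocalDiffeo.comp (𝓡 n) _ (by rw [h.map_zero]; exact g.isLocalDiffeo), by
    rw [Function.comp_apply, h.map_zero, g.map_zero]⟩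

/-- Local inverse. -/
def inv (g : DiffeoAtOrigin n k) : DiffeoAtOrigin n k :=
  ⟨g.isLocalDiffeo.localInverse,
    (congrArg (IsLocalDiffeomorphAt (𝓡 n) (𝓡 n) k g.isLocalDiffeo.localInverse) g.map_zero).mp
      g.isLocalDiffeo.localInverse_isLocalDiffeomorphAt,
    (congrArg g.isLocalDiffeo.localInverse g.map_zero).symm.trans
      (g.isLocalDiffeo.localInverse_left_inv g.isLocalDiffeo.localInverse_mem_target)⟩

theorem comp_congr {g g' h h' : DiffeoAtOrigin n k} (hg : g ≈ g') (hh : h ≈ h') :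
    g.comp h ≈ g'.comp h' :=
  SameJet.trans
    (SameJet.comp_left (f := g.toFun) (by rw [h.map_zero]; exact g.contDiffAt) h.contDiffAt
      h'.contDiffAt hh)
    (SameJet.comp_right (f := g.toFun) (f' := g'.toFun) (g := h'.toFun) g.contDiffAt g'.contDiffAt h'.contDiffAt h'.map_zero hg)

theorem inv_comp (g : DiffeoAtOrigin n k) : g.inv.comp g ≈ one n k :=
  SameJet.of_eventuallyEq g.isLocalDiffeo.localInverse_eventuallyEq_left

theorem comp_inv (g : DiffeoAtOrigin n k) : g.comp g.inv ≈ one n k := by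
  have e : 𝓝 (g.toFun 0) = 𝓝 0 := by rw [g.map_zero]
  exact SameJet.of_eventuallyEq (e ▸ g.isLocalDiffeo.localInverse_eventuallyEq_right)

theorem inv_congr {g h : DiffeoAtOrigin n k} (e : g ≈ h) : g.inv ≈ h.inv := by
  have h1 : g.inv ≈ g.inv.comp (h.comp h.inv) :=
    comp_congr (h := one n k) (Setoid.refl g.inv) (Setoid.symm (comp_inv h))
  have h2 : g.inv.comp (h.comp h.inv) ≈ g.inv.comp (g.comp h.inv) :=
    comp_congr (Setoid.refl _) (comp_congr (Setoid.symm e) (Setoid.refl _))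
  have h3 : (g.inv.comp g).comp h.inv ≈ h.inv :=
    comp_congr (g' := one n k) (inv_comp g) (Setoid.refl h.inv)
  exact Setoid.trans h1 (Setoid.trans h2 h3)

end DiffeoAtOrigin

/-- The group `Dᵏ` of `k`-jets at the origin of `Cᵏ` diffeomorphisms of `ℝⁿ` fixing the origin. -/
def JetGroup (n k : ℕ) : Type := Quotient (DiffeoAtOrigin.jetSetoid n k)

namespace JetGroup

variable {n k : ℕ}

instance instGroup (n k : ℕ) : Group (JetGroup n k) where
  mul := Quotient.map₂ DiffeoAtOrigin.comp fun _ _ hg _ _ hh => DiffeoAtOrigin.comp_congr hg hh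
  one := Quotient.mk _ (DiffeoAtOrigin.one n k)
  inv := Quotient.map DiffeoAtOrigin.inv fun _ _ h => DiffeoAtOrigin.inv_congr h
  mul_assoc a b c := by
    induction a using Quotient.inductionOn
    induction b using Quotient.inductionOn
    induction c using Quotient.inductionOn
    rfl
  one_mul a := by
    induction a using Quotient.inductionOn
    rfl
  mul_one a := by
    induction a using Quotient.inductionOn
    rfl
  inv_mul_cancel a := by
    induction a using Quotient.inductionOn with
    | _ g => exact Quotient.sound (DiffeoAtOrigin.inv_comp g)

end JetGroup

/-! ### The `k`-th order frame bundle `Pᵏ(M)` -/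

section FrameBundle

variable (n k : ℕ) (M : Type*) [TopologicalSpace M] [ChartedSpace (EuclideanSpace ℝ (Fin n)) M]

/-- Local `Cᵏ` parametrisations of `M` near the origin of `ℝⁿ`. -/
structure LocalParam where
  toFun : EuclideanSpace ℝ (Fin n) → M
  isLocalDiffeo : IsLocalDiffeomorphAt (𝓡 n) (𝓡 n) k toFun 0

/-- Two parametrisations are equivalent when they have the same value and, in a chart at this
value, the same `k`-jet at the origin. -/
instance LocalParam.jetSetoid : Setoid (LocalParam n k M) where
  r u v := u.toFun 0 = v.toFun 0 ∧
    SameJet k (chartAt (EuclideanSpace ℝ (Fin n)) (u.toFun 0) ∘ u.toFun)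
      (chartAt (EuclideanSpace ℝ (Fin n)) (u.toFun 0) ∘ v.toFun)
  iseqv := by
    refine ⟨fun u => ⟨rfl, SameJet.refl _⟩, ?_, ?_⟩
    · rintro u v ⟨h, h'⟩
      exact ⟨h.symm, by rw [← h]; exact h'.symm⟩
    · rintro u v w ⟨h, h'⟩ ⟨e, e'⟩
      refine ⟨h.trans e, h'.trans ?_⟩
      rw [h]
      exact e'

/-- The `k`-th order frame bundle: `k`-jets at `0` of local `Cᵏ` diffeomorphisms `ℝⁿ → M`. -/
def FrameBundle : Type _ := Quotient (LocalParam.jetSetoid n k M)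

variable {n k M}

/-- The `k`-frame defined by a local parametrisation. -/
def FrameBundle.mk (u : LocalParam n k M) : FrameBundle n k M := Quotient.mk _ u

/-- The coordinates of a `k`-jet: the value and the derivatives up to order `k` at the origin. -/
def jetCoord (k : ℕ) (f : EuclideanSpace ℝ (Fin n) → EuclideanSpace ℝ (Fin n)) :
    (i : Fin (k + 1)) →
      ContinuousMultilinearMap ℝ (fun _ : Fin i => EuclideanSpace ℝ (Fin n))
        (EuclideanSpace ℝ (Fin n)) :=
  fun i => iteratedFDeriv ℝ i f 0

/-- The topology of the frame bundle: for every chart `φ` of `M`, the frames over the domain of `φ`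
form an open set, which carries the topology given by the jet coordinates of `φ ∘ u`. -/
instance FrameBundle.instTopologicalSpace : TopologicalSpace (FrameBundle n k M) :=
  TopologicalSpace.generateFrom
    {S | ∃ φ ∈ atlas (EuclideanSpace ℝ (Fin n)) M,
      ∃ O : Set ((i : Fin (k + 1)) →
        ContinuousMultilinearMap ℝ (fun _ : Fin i => EuclideanSpace ℝ (Fin n))
          (EuclideanSpace ℝ (Fin n))),
      IsOpen O ∧
      S = {p | ∃ u : LocalParam n k M,
        FrameBundle.mk u = p ∧ u.toFun 0 ∈ φ.source ∧ jetCoord k (φ ∘ u.toFun) ∈ O}}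

theorem LocalParam.contDiffAt_chart (u : LocalParam n k M) :
    ContDiffAt ℝ k (chartAt (EuclideanSpace ℝ (Fin n)) (u.toFun 0) ∘ u.toFun) 0 := by
  have h := (contMDiffAt_iff_target.1 u.isLocalDiffeo.contMDiffAt).2
  simpa using h.contDiffAt

/-- Reparametrisation of a parametrisation by a diffeomorphism germ at the origin. -/
def LocalParam.reparam (u : LocalParam n k M) (g : DiffeoAtOrigin n k) : LocalParam n k M :=
  ⟨u.toFun ∘ g.toFun, g.isLocalDiffeo.comp (𝓡 n) _ (by rw [g.map_zero]; exact u.isLocalDiffeo)⟩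

/-- The (right) principal action of `Dᵏ` on `Pᵏ(M)`, `j(u) · j(g) = j(u ∘ g)`. -/
def FrameBundle.act : FrameBundle n k M → JetGroup n k → FrameBundle n k M :=
  Quotient.map₂ LocalParam.reparam (by
    rintro u v ⟨huv, huv'⟩ g h hgh
    have hz : (u.reparam g).toFun 0 = u.toFun 0 := congrArg u.toFun g.map_zero
    have hz' : (v.reparam h).toFun 0 = v.toFun 0 := congrArg v.toFun h.map_zero
    refine ⟨by rw [hz, hz', huv], ?_⟩
    rw [hz]
    exact SameJet.trans
      (SameJet.comp_left (by rw [g.map_zero]; exact u.contDiffAt_chart) g.contDiffAt h.contDiffAt hgh)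
      (SameJet.comp_right u.contDiffAt_chart (by rw [huv]; exact v.contDiffAt_chart)
        h.contDiffAt h.map_zero huv'))

variable {N : Type*} [TopologicalSpace N] [ChartedSpace (EuclideanSpace ℝ (Fin n)) N]

/-- Composition of a parametrisation with a local diffeomorphism. -/
def LocalParam.push (f : N → M) (hf : IsLocalDiffeomorph (𝓡 n) (𝓡 n) k f)
    (u : LocalParam n k N) : LocalParam n k M :=
  ⟨f ∘ u.toFun, u.isLocalDiffeo.comp (𝓡 n) _ (hf (u.toFun 0))⟩

/-- The map `fᵏ : Pᵏ(N) → Pᵏ(M)`, `j(u) ↦ j(f ∘ u)`, induced by a `Cᵏ` (local) diffeomorphism. -/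
def FrameBundle.map (f : N → M) (hf : IsLocalDiffeomorph (𝓡 n) (𝓡 n) k f) :
    FrameBundle n k N → FrameBundle n k M :=
  Quotient.map (LocalParam.push f hf) (by
    rintro u v ⟨huv, huv'⟩
    refine ⟨congrArg f huv, ?_⟩
    have hF : ContDiffAt ℝ k
        (chartAt (EuclideanSpace ℝ (Fin n)) (f (u.toFun 0)) ∘ f ∘
          (chartAt (EuclideanSpace ℝ (Fin n)) (u.toFun 0)).symm)
        ((chartAt (EuclideanSpace ℝ (Fin n)) (u.toFun 0) ∘ u.toFun) 0) := by
      have h := (contMDiffAt_iff.1 (hf (u.toFun 0)).contMDiffAt).2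
      simpa [ContDiffAt, Function.comp_def] using h
    have key : ∀ w : LocalParam n k N, w.toFun 0 = u.toFun 0 →
        (chartAt (EuclideanSpace ℝ (Fin n)) (f (u.toFun 0)) ∘ f ∘
          (chartAt (EuclideanSpace ℝ (Fin n)) (u.toFun 0)).symm) ∘
          (chartAt (EuclideanSpace ℝ (Fin n)) (u.toFun 0) ∘ w.toFun) =ᶠ[𝓝 0]
        chartAt (EuclideanSpace ℝ (Fin n)) (f (u.toFun 0)) ∘ (w.push f hf).toFun := by
      intro w hw
      have hc : ContinuousAt w.toFun 0 := w.isLocalDiffeo.contMDiffAt.continuousAt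
      have hs : ∀ᶠ x in 𝓝 (0 : EuclideanSpace ℝ (Fin n)),
          w.toFun x ∈ (chartAt (EuclideanSpace ℝ (Fin n)) (u.toFun 0)).source :=
        hc ((chartAt (EuclideanSpace ℝ (Fin n)) (u.toFun 0)).open_source.mem_nhds
          (by rw [hw]; exact mem_chart_source _ _))
      filter_upwards [hs] with x hx
      simp [LocalParam.push, (chartAt (EuclideanSpace ℝ (Fin n)) (u.toFun 0)).left_inv hx]
    exact (SameJet.of_eventuallyEq (key u rfl)).symm.trans
      ((SameJet.comp_left hF u.contDiffAt_chart
        (by rw [huv]; exact v.contDiffAt_chart) huv').trans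
        (SameJet.of_eventuallyEq (key v huv.symm))))

end FrameBundle

/-! ### Smooth actions and orbit equivalence -/

/-- The group `G` acts on `M` by `Cᵏ` diffeomorphisms. -/
def ActsByDiffeos (n : ℕ) (k : ℕ∞ω) (G M : Type*) [Group G] [MulAction G M] [TopologicalSpace M]
    [ChartedSpace (EuclideanSpace ℝ (Fin n)) M] : Prop :=
  ∀ g : G, ContMDiff (𝓡 n) (𝓡 n) k (fun x : M => g • x)

theorem ActsByDiffeos.isLocalDiffeomorph {n : ℕ} {k : ℕ∞ω} {G M : Type*} [Group G] [MulAction G M]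
    [TopologicalSpace M] [ChartedSpace (EuclideanSpace ℝ (Fin n)) M]
    (h : ActsByDiffeos n k G M) (g : G) :
    IsLocalDiffeomorph (𝓡 n) (𝓡 n) k (fun x : M => g • x) :=
  Diffeomorph.isLocalDiffeomorph (Φ :=
    { toEquiv := MulAction.toPerm g
      contMDiff_toFun := h g
      contMDiff_invFun := h g⁻¹ })

/-- The bijection `f : X' → X` carries the orbit relation of `G'` to that of `G`. -/
def MapsOrbitRelation (G' G : Type*) {X' X : Type*} [Group G'] [Group G] [MulAction G' X']
    [MulAction G X] (f : X' → X) : Prop :=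
  ∀ x y : X', x ∈ MulAction.orbit G' y ↔ f x ∈ MulAction.orbit G (f y)

/-! ### Geometric structures -/

/-- A geometric structure of order `k` on `M` with values in a space `V` on which `Dᵏ` acts: a
continuous `Dᵏ`-equivariant map `Pᵏ(M) → V`. The order `k` and the `Dᵏ`-space `V` constitute the
type of the structure. Equivariance relates the right action on `Pᵏ(M)` to the left action on `V`,
whence the inverse. -/
structure GeometricStructure (n k : ℕ) (M V : Type*) [TopologicalSpace M]
    [ChartedSpace (EuclideanSpace ℝ (Fin n)) M] [TopologicalSpace V]
    [MulAction (JetGroup n k) V] where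
  toFun : FrameBundle n k M → V
  continuous_toFun : Continuous toFun
  equivariant : ∀ (p : FrameBundle n k M) (d : JetGroup n k), toFun (p.act d) = d⁻¹ • toFun p

/-- The action of `G` preserves the geometric structure `η`: one has `η ∘ gᵏ = η` for all `g`. -/
def GeometricStructure.PreservedBy {n k : ℕ} {M V : Type*} [TopologicalSpace M]
    [ChartedSpace (EuclideanSpace ℝ (Fin n)) M] [TopologicalSpace V] [MulAction (JetGroup n k) V]
    (η : GeometricStructure n k M V) {G : Type*} [Group G] [MulAction G M]
    (hG : ActsByDiffeos n k G M) : Prop :=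
  ∀ (g : G) (p : FrameBundle n k M),
    η.toFun (FrameBundle.map (fun x : M => g • x) (hG.isLocalDiffeomorph g) p) = η.toFun p

/-! ### Differential forms, volume forms and symplectic forms -/

section Forms

variable {n : ℕ} {M N : Type*} [TopologicalSpace M] [ChartedSpace (EuclideanSpace ℝ (Fin n)) M]
  [TopologicalSpace N] [ChartedSpace (EuclideanSpace ℝ (Fin n)) N] {p : ℕ}

/-- Differential `p`-forms (without regularity) on an `n`-dimensional manifold. -/
abbrev DiffForm (n p : ℕ) (M : Type*) [TopologicalSpace M]
    [ChartedSpace (EuclideanSpace ℝ (Fin n)) M] : Type _ :=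
  (x : M) → TangentSpace (𝓡 n) x [⋀^Fin p]→L[ℝ] ℝ

namespace DiffForm

/-- The expression of a form in a chart, that is, its pullback under the inverse of the chart. -/
def inChart (η : DiffForm n p M)
    (φ : OpenPartialHomeomorph M (EuclideanSpace ℝ (Fin n))) (y : EuclideanSpace ℝ (Fin n)) :
    EuclideanSpace ℝ (Fin n) [⋀^Fin p]→L[ℝ] ℝ :=
  (η (φ.symm y)).compContinuousLinearMap (mfderiv (𝓡 n) (𝓡 n) φ.symm y)

/-- The form is smooth in every chart of the atlas. -/
def Smooth (η : DiffForm n p M) : Prop :=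
  ∀ φ ∈ atlas (EuclideanSpace ℝ (Fin n)) M, ContDiffOn ℝ ∞ (η.inChart φ) φ.target

/-- The exterior derivative vanishes in every chart of the atlas. -/
def Closed (η : DiffForm n p M) : Prop :=
  ∀ φ ∈ atlas (EuclideanSpace ℝ (Fin n)) M, ∀ y ∈ φ.target, extDeriv (η.inChart φ) y = 0

/-- The pullback of a form. -/
def pullback (f : N → M) (η : DiffForm n p M) : DiffForm n p N :=
  fun x => (η (f x)).compContinuousLinearMap (mfderiv (𝓡 n) (𝓡 n) f x)

/-- The action of `G` on `M` preserves the form. -/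
def PreservedBy (η : DiffForm n p M) (G : Type*) [Group G] [MulAction G M] : Prop :=
  ∀ g : G, η.pullback (fun x : M => g • x) = η

/-- A volume form: a smooth nowhere vanishing form of top degree. -/
def IsVolumeForm (η : DiffForm n n M) : Prop :=
  η.Smooth ∧ ∀ x, η x ≠ 0

/-- A symplectic form: a smooth closed nondegenerate `2`-form. -/
def IsSymplecticForm (η : DiffForm n 2 M) : Prop :=
  η.Smooth ∧ η.Closed ∧
    ∀ (x : M) (v : TangentSpace (𝓡 n) x), (∀ w : TangentSpace (𝓡 n) x, η x ![v, w] = 0) → v = 0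

end DiffForm

end Forms

end

/-! Fix `g'` in `Γ'`. Since `f (g' • x)` lies in the `Γ`-orbit of `f x` for every `x`, the space `N`
is the union of the closed sets `{x | f (g' • x) = g • f x}`, one for each `g` in the countable
group `Γ`. As `N` is homeomorphic to the compact Hausdorff space `M`, Baire's theorem makes the
union of their interiors dense (`dense_iUnion_interior_coincidence`). At a point of one of these
interiors `f ∘ g'` and `g ∘ f` have the same germ, hence the same jets, so invariance of `ω` under
`g` gives invariance of its pullback under `g'` there.

It remains to pass to the closure. For geometric structures this uses continuity of the induced maps
of frame bundles (`FrameBundle.continuous_map`, via Faà di Bruno), density of the frames lying over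
a dense set (`FrameBundle.dense_preimage_base`), and the Hausdorff property of `V`. For forms it
uses continuity of the coefficients (`DiffForm.Smooth.eq_of_eqOn_dense`). That pullbacks are again
volume or symplectic forms follows from the chart formula `DiffForm.inChart_pullback`, naturality of
the exterior derivative, and invertibility of the differential of `f`. -/

noncomputable section

/-! ### Changes of charts -/

section Charts

variable {n : ℕ} {m : ℕ∞ω} {M N : Type*}
  [TopologicalSpace M] [ChartedSpace (EuclideanSpace ℝ (Fin n)) M] [IsManifold (𝓡 n) m M]
  [TopologicalSpace N] [ChartedSpace (EuclideanSpace ℝ (Fin n)) N] [IsManifold (𝓡 n) m N]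

/-- The expression in charts of a `Cᵐ` map is `Cᵐ`. -/
theorem ContMDiff.contDiffAt_in_charts {f : N → M} (hf : ContMDiff (𝓡 n) (𝓡 n) m f)
    {φ : OpenPartialHomeomorph M (EuclideanSpace ℝ (Fin n))}
    (hφ : φ ∈ atlas (EuclideanSpace ℝ (Fin n)) M)
    {ψ : OpenPartialHomeomorph N (EuclideanSpace ℝ (Fin n))}
    (hψ : ψ ∈ atlas (EuclideanSpace ℝ (Fin n)) N)
    {y : EuclideanSpace ℝ (Fin n)} (hy : y ∈ ψ.target) (hfy : f (ψ.symm y) ∈ φ.source) :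
    ContDiffAt ℝ m (φ ∘ f ∘ ψ.symm) y := by
  have h1 := contMDiffAt_of_mem_maximalAtlas (I := 𝓡 n) (n := m)
    (IsManifold.subset_maximalAtlas hφ) hfy
  have h2 := contMDiffAt_symm_of_mem_maximalAtlas (I := 𝓡 n) (n := m)
    (IsManifold.subset_maximalAtlas hψ) hy
  exact (h1.comp y ((hf _).comp y h2)).contDiffAt

end Charts

/-! ### Jets of compositions -/

section Jets

variable {n k : ℕ}

/-- Composition of the jets of `F` with a jet `J`, by the formula of Faà di Bruno. -/
def jetComp (k : ℕ) (F : EuclideanSpace ℝ (Fin n) → EuclideanSpace ℝ (Fin n))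
    (J : (i : Fin (k + 1)) → ContinuousMultilinearMap ℝ
      (fun _ : Fin i => EuclideanSpace ℝ (Fin n)) (EuclideanSpace ℝ (Fin n)))
    (i : Fin (k + 1)) : ContinuousMultilinearMap ℝ
      (fun _ : Fin i => EuclideanSpace ℝ (Fin n)) (EuclideanSpace ℝ (Fin n)) :=
  ∑ c : OrderedFinpartition i, c.compAlongOrderedFinpartition
    (iteratedFDeriv ℝ c.length F (J 0 Fin.elim0))
    (fun m => J ⟨c.partSize m, (c.partSize_le m).trans_lt i.2⟩)

theorem jetCoord_zero (g : EuclideanSpace ℝ (Fin n) → EuclideanSpace ℝ (Fin n)) :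
    jetCoord k g 0 Fin.elim0 = g 0 := iteratedFDeriv_zero_apply _

theorem jetCoord_congr {f g : EuclideanSpace ℝ (Fin n) → EuclideanSpace ℝ (Fin n)}
    (h : SameJet k f g) : jetCoord k f = jetCoord k g :=
  funext fun i => h i (Nat.lt_succ_iff.1 i.2)

theorem jetCoord_comp {F g : EuclideanSpace ℝ (Fin n) → EuclideanSpace ℝ (Fin n)}
    (hF : ContDiffAt ℝ k F (g 0)) (hg : ContDiffAt ℝ k g 0) :
    jetCoord k (F ∘ g) = jetComp k F (jetCoord k g) := by
  funext i
  have hi : ((i : ℕ) : ℕ∞ω) ≤ (k : ℕ∞ω) := by exact_mod_cast Nat.lt_succ_iff.1 i.2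
  rw [jetComp, jetCoord_zero]
  exact iteratedFDeriv_comp hF hg hi

/-- The value of a jet depends continuously on its coordinates. -/
theorem continuous_jet_value : Continuous fun J : (i : Fin (k + 1)) → ContinuousMultilinearMap ℝ
    (fun _ : Fin i => EuclideanSpace ℝ (Fin n)) (EuclideanSpace ℝ (Fin n)) => J 0 Fin.elim0 :=
  (ContinuousMultilinearMap.apply ℝ (fun _ : Fin (0 : Fin (k + 1)) => EuclideanSpace ℝ (Fin n))
    (EuclideanSpace ℝ (Fin n)) Fin.elim0).continuous.comp (continuous_apply 0)

/-- Each Faà di Bruno term is multilinear in the inner jet, and its outer factor is a derivative of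
`F` of order at most `k` at the moving point `J 0`. Only continuity at `J` is available, since `F`
is controlled only near one value. -/
theorem continuousAt_jetComp {F : EuclideanSpace ℝ (Fin n) → EuclideanSpace ℝ (Fin n)}
    {J : (i : Fin (k + 1)) → ContinuousMultilinearMap ℝ
      (fun _ : Fin i => EuclideanSpace ℝ (Fin n)) (EuclideanSpace ℝ (Fin n))}
    (hF : ContDiffAt ℝ k F (J 0 Fin.elim0)) : ContinuousAt (jetComp k F) J := by
  refine continuousAt_pi.2 fun i => tendsto_finsetSum _ fun c _ => ?_
  have hc : (c.length : ℕ∞ω) ≤ (k : ℕ∞ω) := by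
    exact_mod_cast c.length_le.trans (Nat.lt_succ_iff.1 i.2)
  have h1 := ContinuousAt.comp (f := fun J : (i : Fin (k + 1)) → ContinuousMultilinearMap ℝ
      (fun _ : Fin i => EuclideanSpace ℝ (Fin n)) (EuclideanSpace ℝ (Fin n)) =>
      J 0 Fin.elim0) (hF.continuousAt_iteratedFDeriv hc)
      continuous_jet_value.continuousAt
  have h2 := ((c.compAlongOrderedFinpartitionL ℝ (EuclideanSpace ℝ (Fin n))
    (EuclideanSpace ℝ (Fin n)) (EuclideanSpace ℝ (Fin n))).continuous.continuousAt.comp h1)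
  have h3 : ContinuousAt (fun (J : (i : Fin (k + 1)) → ContinuousMultilinearMap ℝ
      (fun _ : Fin i => EuclideanSpace ℝ (Fin n)) (EuclideanSpace ℝ (Fin n)))
      (m : Fin c.length) => J ⟨c.partSize m, (c.partSize_le m).trans_lt i.2⟩) J :=
    continuousAt_pi.2 fun m => (continuous_apply _).continuousAt
  exact h2.eval h3

end Jets

/-! ### The topology of the frame bundle -/

namespace FrameBundle

variable {n k : ℕ} {M N : Type*}
  [TopologicalSpace M] [ChartedSpace (EuclideanSpace ℝ (Fin n)) M]
  [TopologicalSpace N] [ChartedSpace (EuclideanSpace ℝ (Fin n)) N]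

theorem _root_.LocalParam.continuousAt (u : LocalParam n k M) : ContinuousAt u.toFun 0 :=
  u.isLocalDiffeo.contMDiffAt.continuousAt

theorem _root_.LocalParam.contDiffAt_comp [IsManifold (𝓡 n) k M] (u : LocalParam n k M)
    {φ : OpenPartialHomeomorph M (EuclideanSpace ℝ (Fin n))}
    (hφ : φ ∈ atlas (EuclideanSpace ℝ (Fin n)) M) (h : u.toFun 0 ∈ φ.source) :
    ContDiffAt ℝ k (φ ∘ u.toFun) 0 :=
  ((contMDiffAt_of_mem_maximalAtlas (I := 𝓡 n) (n := k)
    (IsManifold.subset_maximalAtlas hφ) h).comp 0 u.isLocalDiffeo.contMDiffAt).contDiffAt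

/-- Insertion of a chart between a map and a parametrisation. -/
theorem _root_.LocalParam.in_chart_eventuallyEq (u : LocalParam n k N) {X : Type*} (f : N → X)
    {ψ : OpenPartialHomeomorph N (EuclideanSpace ℝ (Fin n))} (h : u.toFun 0 ∈ ψ.source) :
    (f ∘ ψ.symm) ∘ (ψ ∘ u.toFun) =ᶠ[𝓝 0] f ∘ u.toFun := by
  filter_upwards [u.continuousAt (ψ.open_source.mem_nhds h)] with x hx
  exact congrArg f (ψ.left_inv hx)

/-- The jet coordinates of `f ∘ u` in terms of those of `u`. -/
theorem _root_.LocalParam.jetCoord_comp [IsManifold (𝓡 n) k M] [IsManifold (𝓡 n) k N]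
    (u : LocalParam n k N) {f : N → M} (hf : ContMDiff (𝓡 n) (𝓡 n) k f)
    {φ : OpenPartialHomeomorph M (EuclideanSpace ℝ (Fin n))}
    (hφ : φ ∈ atlas (EuclideanSpace ℝ (Fin n)) M)
    {ψ : OpenPartialHomeomorph N (EuclideanSpace ℝ (Fin n))}
    (hψ : ψ ∈ atlas (EuclideanSpace ℝ (Fin n)) N)
    (hu : u.toFun 0 ∈ ψ.source) (hfu : f (u.toFun 0) ∈ φ.source) :
    jetCoord k (φ ∘ f ∘ u.toFun) = jetComp k (φ ∘ f ∘ ψ.symm) (jetCoord k (ψ ∘ u.toFun)) := by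
  rw [← _root_.jetCoord_comp (hf.contDiffAt_in_charts hφ hψ (ψ.map_source hu)
    (by simpa [ψ.left_inv hu] using hfu)) (u.contDiffAt_comp hψ hu)]
  exact (jetCoord_congr (SameJet.of_eventuallyEq (u.in_chart_eventuallyEq (φ ∘ f) hu))).symm

theorem mk_eq_of_eventuallyEq {u v : LocalParam n k M} (h : u.toFun =ᶠ[𝓝 0] v.toFun) :
    mk u = mk v :=
  Quotient.sound ⟨h.eq_of_nhds, SameJet.of_eventuallyEq (h.fun_comp _)⟩

/-- The base point of a frame. -/
def base : FrameBundle n k M → M := Quotient.lift (fun u => u.toFun 0) fun _ _ h => h.1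

/-- The frames over the domain of a chart with prescribed jet coordinates in this chart. -/
def chartSet (k : ℕ) (φ : OpenPartialHomeomorph M (EuclideanSpace ℝ (Fin n)))
    (O : Set ((i : Fin (k + 1)) → ContinuousMultilinearMap ℝ
      (fun _ : Fin i => EuclideanSpace ℝ (Fin n)) (EuclideanSpace ℝ (Fin n)))) :
    Set (FrameBundle n k M) :=
  {p | ∃ u : LocalParam n k M, mk u = p ∧ u.toFun 0 ∈ φ.source ∧ jetCoord k (φ ∘ u.toFun) ∈ O}

theorem isOpen_chartSet {φ : OpenPartialHomeomorph M (EuclideanSpace ℝ (Fin n))}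
    (hφ : φ ∈ atlas (EuclideanSpace ℝ (Fin n)) M)
    {O : Set ((i : Fin (k + 1)) → ContinuousMultilinearMap ℝ
      (fun _ : Fin i => EuclideanSpace ℝ (Fin n)) (EuclideanSpace ℝ (Fin n)))} (hO : IsOpen O) :
    IsOpen (chartSet k φ O) :=
  TopologicalSpace.isOpen_generateFrom_of_mem ⟨φ, hφ, O, hO, rfl⟩

/-- Equality of frames is tested in the preferred chart at the base point. The Faà di Bruno formula
for the transition map carries it to `φ`, so membership does not depend on the representative. -/
theorem mk_mem_chartSet_iff [IsManifold (𝓡 n) k M] (v : LocalParam n k M)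
    {φ : OpenPartialHomeomorph M (EuclideanSpace ℝ (Fin n))}
    (hφ : φ ∈ atlas (EuclideanSpace ℝ (Fin n)) M)
    {O : Set ((i : Fin (k + 1)) → ContinuousMultilinearMap ℝ
      (fun _ : Fin i => EuclideanSpace ℝ (Fin n)) (EuclideanSpace ℝ (Fin n)))} :
    mk v ∈ chartSet k φ O ↔ v.toFun 0 ∈ φ.source ∧ jetCoord k (φ ∘ v.toFun) ∈ O := by
  refine ⟨?_, fun h => ⟨v, rfl, h⟩⟩
  rintro ⟨u, huv, hu, hO⟩
  obtain ⟨h0, hj⟩ := Quotient.exact huv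
  have hv : v.toFun 0 ∈ φ.source := h0 ▸ hu
  refine ⟨hv, ?_⟩
  have hψ := chart_mem_atlas (EuclideanSpace ℝ (Fin n)) (u.toFun 0)
  have hs := mem_chart_source (EuclideanSpace ℝ (Fin n)) (u.toFun 0)
  -- With `f = id` the map read in charts is the transition from the preferred chart to `φ`.
  have e := v.jetCoord_comp (f := id) contMDiff_id hφ hψ (h0 ▸ hs) hv
  rw [← jetCoord_congr hj, ← u.jetCoord_comp (f := id) contMDiff_id hφ hψ hs hu] at e
  exact e.symm ▸ hO

/-- In charts the induced map is `jetComp` of the local expression of `f`, so continuity reduces to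
`continuousAt_jetComp`. -/
theorem continuous_map [IsManifold (𝓡 n) k M] [IsManifold (𝓡 n) k N] (f : N → M)
    (hf : IsLocalDiffeomorph (𝓡 n) (𝓡 n) k f) : Continuous (map f hf) := by
  refine continuous_generateFrom_iff.2 ?_
  rintro _ ⟨φ, hφ, O, hO, rfl⟩
  refine isOpen_iff_mem_nhds.2 fun p hp => ?_
  induction p using Quotient.inductionOn with | _ u
  obtain ⟨hu, huO⟩ := (mk_mem_chartSet_iff (u.push f hf) hφ).1 hp
  replace hu : f (u.toFun 0) ∈ φ.source := hu
  have hψ := chart_mem_atlas (EuclideanSpace ℝ (Fin n)) (u.toFun 0)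
  have hs := mem_chart_source (EuclideanSpace ℝ (Fin n)) (u.toFun 0)
  set ψ := chartAt (EuclideanSpace ℝ (Fin n)) (u.toFun 0)
  have hF := hf.contMDiff.contDiffAt_in_charts hφ hψ (ψ.map_source hs)
    (by simpa [ψ.left_inv hs] using hu)
  have hF' : ContDiffAt ℝ k (φ ∘ f ∘ ψ.symm) (jetCoord k (ψ ∘ u.toFun) 0 Fin.elim0) := by
    rwa [jetCoord_zero]
  have hJ : ContinuousAt (jetComp k (φ ∘ f ∘ ψ.symm)) (jetCoord k (ψ ∘ u.toFun)) :=
    continuousAt_jetComp hF'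
  have huO' : jetComp k (φ ∘ f ∘ ψ.symm) (jetCoord k (ψ ∘ u.toFun)) ∈ O := by
    rw [← u.jetCoord_comp hf.contMDiff hφ hψ hs hu]; exact huO
  -- Nearby jets must also have their base point sent into the domain of `φ`, for otherwise the
  -- coordinate formula does not apply. This is an open condition on the value of the jet.
  have hW : IsOpen (ψ.target ∩ ψ.symm ⁻¹' (f ⁻¹' φ.source)) :=
    ψ.symm.isOpen_inter_preimage (φ.open_source.preimage hf.contMDiff.continuous)
  have hW' : jetCoord k (ψ ∘ u.toFun) 0 Fin.elim0 ∈
      ψ.target ∩ ψ.symm ⁻¹' (f ⁻¹' φ.source) := by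
    rw [jetCoord_zero]
    exact ⟨ψ.map_source hs, by simpa [ψ.left_inv hs] using hu⟩
  have hmem := Filter.inter_mem (Filter.mem_map.1 (hJ (hO.mem_nhds huO')))
    (Filter.mem_map.1 (continuous_jet_value.continuousAt (hW.mem_nhds hW')))
  obtain ⟨O', hO'sub, hO', huO'⟩ := mem_nhds_iff.1 hmem
  refine Filter.mem_of_superset ((isOpen_chartSet hψ hO').mem_nhds ⟨u, rfl, hs, huO'⟩) ?_
  rintro _ ⟨v, rfl, hv, hvO⟩
  obtain ⟨h1, h2⟩ := hO'sub hvO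
  have h3 : f (v.toFun 0) ∈ φ.source := by
    have h4 : jetCoord k (ψ ∘ v.toFun) 0 Fin.elim0 ∈ ψ.symm ⁻¹' (f ⁻¹' φ.source) := h2.2
    rw [jetCoord_zero] at h4
    simpa [ψ.left_inv hv] using h4
  refine (mk_mem_chartSet_iff (v.push f hf) hφ).2 ⟨h3, ?_⟩
  have e := v.jetCoord_comp hf.contMDiff hφ hψ hv h3
  exact e.symm ▸ h1

/-- The frames over a dense set of points are dense. -/
theorem dense_preimage_base [IsManifold (𝓡 n) k M] {D : Set M} (hD : Dense D) :
    Dense (base ⁻¹' D : Set (FrameBundle n k M)) := by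
  intro p
  induction p using Quotient.inductionOn with | _ u
  obtain ⟨Φ, h0, hΦ⟩ := u.isLocalDiffeo
  -- A frame is moved to nearby base points by translating its parametrisation in the source: `y ↦ u
  -- (t + y)` is a frame at `u t`.
  have hloc : ∀ t ∈ Φ.source,
      IsLocalDiffeomorphAt (𝓡 n) (𝓡 n) k (fun y => u.toFun (t + y)) 0 := by
    intro t ht
    have h1 : IsLocalDiffeomorphAt (𝓡 n) (𝓡 n) k u.toFun (t + 0) :=
      ⟨Φ, by simpa using ht, hΦ⟩
    have h2 : ContDiff ℝ k (fun y : EuclideanSpace ℝ (Fin n) => t + y) :=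
      contDiff_const.add contDiff_id
    have h3 : ContDiff ℝ k (fun y : EuclideanSpace ℝ (Fin n) => -t + y) :=
      contDiff_const.add contDiff_id
    exact (Diffeomorph.isLocalDiffeomorph (Φ :=
      { toEquiv := Equiv.addLeft t
        contMDiff_toFun := h2.contMDiff
        contMDiff_invFun := h3.contMDiff }) 0).comp (𝓡 n) _ h1
  classical
  let s : EuclideanSpace ℝ (Fin n) → FrameBundle n k M := fun t =>
    if ht : t ∈ Φ.source then mk ⟨fun y => u.toFun (t + y), hloc t ht⟩ else mk u
  have hs0 : s 0 = mk u := by simp [s, h0]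
  have hcont : Filter.Tendsto s (𝓝 0) (𝓝 (mk u)) := by
    refine TopologicalSpace.tendsto_nhds_generateFrom_iff.2 ?_
    rintro _ ⟨φ, hφ, O, hO, rfl⟩ hu
    obtain ⟨hu, huO⟩ := (mk_mem_chartSet_iff u hφ).1 hu
    have hj : ContinuousAt (fun (t : EuclideanSpace ℝ (Fin n)) (i : Fin (k + 1)) =>
        iteratedFDeriv ℝ i (φ ∘ u.toFun) t) 0 :=
      continuousAt_pi.2 fun i => (u.contDiffAt_comp hφ hu).continuousAt_iteratedFDeriv
        (by exact_mod_cast Nat.lt_succ_iff.1 i.2)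
    filter_upwards [Φ.open_source.mem_nhds h0, hj (hO.mem_nhds huO),
      u.continuousAt (φ.open_source.mem_nhds hu)] with t ht htO htu
    simp only [s, Set.mem_preimage, dif_pos ht]
    refine ⟨_, rfl, by simpa using htu, ?_⟩
    have e : jetCoord k (φ ∘ fun y => u.toFun (t + y)) =
        fun i : Fin (k + 1) => iteratedFDeriv ℝ i (φ ∘ u.toFun) t := by
      funext i
      have := iteratedFDeriv_comp_add_left (𝕜 := ℝ) (f := φ ∘ u.toFun) i t 0
      simpa [jetCoord, Function.comp_def] using this
    exact e.symm ▸ htO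
  refine mem_closure_of_frequently_of_tendsto (f := s) ?_ hcont
  refine Filter.frequently_iff.2 fun {U} hU => ?_
  obtain ⟨U', hU'U, hU', h0U'⟩ := mem_nhds_iff.1 hU
  -- The base points `u t` for `t` near `0` fill a nonempty open set, which therefore meets `D`.
  have hopen := Φ.toOpenPartialHomeomorph.isOpen_image_of_subset_source
    (hU'.inter Φ.open_source) Set.inter_subset_right
  obtain ⟨_, hxD, t, ⟨htU, ht⟩, rfl⟩ := hD.exists_mem_open hopen ⟨_, ⟨0, ⟨h0U', h0⟩, rfl⟩⟩
  refine ⟨t, hU'U htU, ?_⟩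
  have : u.toFun t ∈ D := hΦ ht ▸ hxD
  simp only [s, dif_pos ht]
  change u.toFun (t + 0) ∈ D
  rwa [add_zero]

end FrameBundle

/-! ### Orbit equivalences -/

/-- If a homeomorphism `f` onto a compact Hausdorff space carries the orbit relation of `G'` to that
of a countable group `G`, then for each `g'` the interiors of the sets where `f ∘ g' = g ∘ f`, for
`g` in `G`, have a dense union. -/
theorem dense_iUnion_interior_coincidence {G' G X' X : Type*} [Group G'] [Group G] [Countable G]
    [TopologicalSpace X'] [TopologicalSpace X] [CompactSpace X] [T2Space X]
    [MulAction G' X'] [MulAction G X] (hG' : ∀ g : G', Continuous fun x : X' => g • x)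
    (hG : ∀ g : G, Continuous fun x : X => g • x) (f : X' ≃ₜ X) (hf : MapsOrbitRelation G' G f)
    (g' : G') : Dense (⋃ g : G, interior {x : X' | f (g' • x) = g • f x}) := by
  -- Transported along `f`, these properties make `X'` a Baire space; the Hausdorff property of `X`
  -- makes the coincidence sets closed.
  have : CompactSpace X' := f.symm.compactSpace
  have : T2Space X' := f.symm.t2Space
  refine dense_iUnion_interior_of_closed
    (fun g => isClosed_eq (f.continuous.comp (hG' g')) ((hG g).comp f.continuous)) ?_
  refine Set.eq_univ_of_forall fun x => Set.mem_iUnion.2 ?_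
  obtain ⟨g, hg⟩ := (hf (g' • x) x).1 (MulAction.mem_orbit x g')
  exact ⟨g, hg.symm⟩

/-! ### Pullback of geometric structures and its invariance. -/

section GeometricStructures

variable {n k : ℕ} {M N V : Type*}
  [TopologicalSpace M] [ChartedSpace (EuclideanSpace ℝ (Fin n)) M] [IsManifold (𝓡 n) k M]
  [TopologicalSpace N] [ChartedSpace (EuclideanSpace ℝ (Fin n)) N] [IsManifold (𝓡 n) k N]
  [TopologicalSpace V] [MulAction (JetGroup n k) V]

/-- The pullback of a geometric structure. -/
def GeometricStructure.pullback (η : GeometricStructure n k M V) (f : N → M)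
    (hf : IsLocalDiffeomorph (𝓡 n) (𝓡 n) k f) : GeometricStructure n k N V where
  toFun p := η.toFun (FrameBundle.map f hf p)
  continuous_toFun := η.continuous_toFun.comp (FrameBundle.continuous_map f hf)
  equivariant p d := by
    rw [← η.equivariant]
    -- On representatives both frames are the jet of `f ∘ u ∘ g`.
    induction p using Quotient.inductionOn
    induction d using Quotient.inductionOn
    rfl

theorem GeometricStructure.PreservedBy.pullback [T2Space V] {G G' : Type*} [Group G] [Countable G]
    [Group G'] [MulAction G M] [MulAction G' N] [CompactSpace M] [T2Space M]
    {hG : ActsByDiffeos n k G M} (hG' : ActsByDiffeos n k G' N) {η : GeometricStructure n k M V}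
    (hη : η.PreservedBy hG) (f : N ≃ₘ^k⟮𝓡 n, 𝓡 n⟯ M) (hf : MapsOrbitRelation G' G f) :
    (η.pullback f f.isLocalDiffeomorph).PreservedBy hG' := by
  intro g'
  refine congrFun (Continuous.ext_on
    (FrameBundle.dense_preimage_base (dense_iUnion_interior_coincidence
      (fun g => (hG' g).continuous) (fun g => (hG g).continuous) f.toHomeomorph hf g'))
    ((η.pullback f f.isLocalDiffeomorph).continuous_toFun.comp (FrameBundle.continuous_map _ _))
    (η.pullback f f.isLocalDiffeomorph).continuous_toFun ?_)
  intro p hp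
  induction p using Quotient.inductionOn with | _ u
  obtain ⟨g, hg⟩ := Set.mem_iUnion.1 hp
  -- The germs of `f ∘ g' ∘ u` and `g ∘ f ∘ u` at `0` agree, so they define one frame, and the
  -- invariance of `η` under `g` removes `g`.
  refine Eq.trans ?_ (hη g (FrameBundle.mk (u.push f f.isLocalDiffeomorph)))
  refine congrArg η.toFun (FrameBundle.mk_eq_of_eventuallyEq
    (u := (u.push _ (hG'.isLocalDiffeomorph g')).push f f.isLocalDiffeomorph)
    (v := (u.push f f.isLocalDiffeomorph).push _ (hG.isLocalDiffeomorph g)) ?_)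
  filter_upwards [u.continuousAt (isOpen_interior.mem_nhds hg)] with x hx
  exact (interior_subset hx :
    u.toFun x ∈ {y : N | f.toHomeomorph (g' • y) = g • f.toHomeomorph y})

end GeometricStructures

/-! ### Pullback of differential forms -/

/-! ### Smooth dependence of pulled-back alternating maps on the form and the linear map. -/

section CompContinuousLinearMap

variable {E F G X : Type*} [NormedAddCommGroup E] [NormedSpace ℝ E]
  [NormedAddCommGroup F] [NormedSpace ℝ F] [NormedAddCommGroup G] [NormedSpace ℝ G]
  [NormedAddCommGroup X] [NormedSpace ℝ X] {p : ℕ}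

/-- Alternatization of continuous multilinear maps divided by the factorial of the number of
variables, a left inverse of the inclusion of the alternating maps. -/
def alternatizationCLM (E G : Type*) [NormedAddCommGroup E] [NormedSpace ℝ E]
    [NormedAddCommGroup G] [NormedSpace ℝ G] (p : ℕ) :
    ContinuousMultilinearMap ℝ (fun _ : Fin p => E) G →L[ℝ] E [⋀^Fin p]→L[ℝ] G :=
  LinearMap.mkContinuous
    { toFun f := ContinuousMultilinearMap.alternatization f
      map_add' f g := map_add _ f g
      map_smul' c f := by
        ext v
        simp [ContinuousMultilinearMap.alternatization_apply_apply, Finset.smul_sum, smul_comm c] }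
    -- Alternatization sums `p!` terms, each bounded by `‖f‖ * ∏ i, ‖v i‖`.
    p.factorial (fun f => by
      refine ContinuousAlternatingMap.opNorm_le_bound _ (by positivity) fun v => ?_
      simp only [LinearMap.coe_mk, AddHom.coe_mk,
        ContinuousMultilinearMap.alternatization_apply_apply]
      refine (norm_sum_le _ _).trans ?_
      have : ∀ σ : Equiv.Perm (Fin p), ‖Equiv.Perm.sign σ • f (v ∘ σ)‖ ≤ ‖f‖ * ∏ i, ‖v i‖ := by
        intro σ
        have h := f.le_opNorm (v ∘ σ)
        rw [show ∏ i, ‖(v ∘ σ) i‖ = ∏ i, ‖v i‖ from Equiv.prod_comp σ fun i => ‖v i‖] at h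
        rcases Int.units_eq_one_or (Equiv.Perm.sign σ) with e | e <;> simpa [e] using h
      refine (Finset.sum_le_sum fun σ _ => this σ).trans (le_of_eq ?_)
      simp [Finset.card_univ, Fintype.card_perm, mul_assoc])

/-- On an alternating map the sign from permuting the arguments cancels the sign in the sum, so all
`p!` terms equal `f`. -/
theorem alternatizationCLM_apply_toContinuousMultilinearMap (f : E [⋀^Fin p]→L[ℝ] G) :
    alternatizationCLM E G p f.toContinuousMultilinearMap = (p.factorial : ℝ) • f := by
  ext v
  have h : ∀ σ : Equiv.Perm (Fin p), Equiv.Perm.sign σ • f (v ∘ σ) = f v := fun σ => by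
    rw [show f (v ∘ σ) = Equiv.Perm.sign σ • f v from f.toAlternatingMap.map_perm v σ, smul_smul,
      Int.units_mul_self, one_smul]
  simp [alternatizationCLM, ContinuousMultilinearMap.alternatization_apply_apply, h,
    Finset.card_univ, Fintype.card_perm, Nat.cast_smul_eq_nsmul]

/-- The pullback of a `Cᵐ` family of alternating maps under a `Cᵐ` family of linear maps. -/
theorem ContDiffAt.continuousAlternatingMap_compContinuousLinearMap {m : ℕ∞ω} {x : X}
    {f : X → F [⋀^Fin p]→L[ℝ] G} {g : X → E →L[ℝ] F} (hf : ContDiffAt ℝ m f x)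
    (hg : ContDiffAt ℝ m g x) :
    ContDiffAt ℝ m (fun y => (f y).compContinuousLinearMap (g y)) x := by
  have hp : (p.factorial : ℝ) ≠ 0 := by exact_mod_cast p.factorial_ne_zero
  have h1 : ContDiffAt ℝ m (fun y => (f y).toContinuousMultilinearMap) x :=
    (ContinuousAlternatingMap.toContinuousMultilinearMapCLM (E := F) (F := G) (ι := Fin p) (𝕜 := ℝ)
      ℝ).contDiff.contDiffAt.comp x hf
  -- Precomposition is continuous multilinear in the tuple of linear maps, hence smooth; here every
  -- slot is `g y`.
  have h2 : ContDiffAt ℝ m (fun y =>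
      ContinuousMultilinearMap.compContinuousLinearMapContinuousMultilinear ℝ
        (fun _ : Fin p => E) (fun _ => F) G (fun _ => g y)) x :=
    (ContinuousMultilinearMap.contDiff _).contDiffAt.comp x (contDiffAt_pi.2 fun _ => hg)
  -- Alternatization returns from multilinear to alternating maps, and `(p!)⁻¹` undoes its scaling.
  have h3 := ((alternatizationCLM E G p).contDiff.contDiffAt.comp x
    (h2.clm_apply h1)).const_smul (p.factorial : ℝ)⁻¹
  refine h3.congr_of_eventuallyEq (Filter.Eventually.of_forall fun y => ?_)
  have := alternatizationCLM_apply_toContinuousMultilinearMap ((f y).compContinuousLinearMap (g y))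
  exact ((inv_smul_eq_iff₀ hp).2 this).symm

end CompContinuousLinearMap

/-! ### Functoriality of the pullback of forms and its expression in charts. -/

namespace DiffForm

variable {n p : ℕ} {M N P : Type*}
  [TopologicalSpace M] [ChartedSpace (EuclideanSpace ℝ (Fin n)) M]
  [TopologicalSpace N] [ChartedSpace (EuclideanSpace ℝ (Fin n)) N]
  [TopologicalSpace P] [ChartedSpace (EuclideanSpace ℝ (Fin n)) P]

/-- All tangent spaces unfold to the model space; the ascriptions allow values at propositionally
equal points to be compared without casts. -/
theorem apply_congr (η : DiffForm n p M) {x x' : M} (h : x = x')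
    {v v' : Fin p → EuclideanSpace ℝ (Fin n)} (hv : v = v') :
    (η x : EuclideanSpace ℝ (Fin n) [⋀^Fin p]→L[ℝ] ℝ) v =
      (η x' : EuclideanSpace ℝ (Fin n) [⋀^Fin p]→L[ℝ] ℝ) v' := by
  subst h hv
  rfl

theorem pullback_congr (η : DiffForm n p M) {f g : N → M} {x : N} (h : f =ᶠ[𝓝 x] g) :
    η.pullback f x = η.pullback g x := by
  ext v
  exact η.apply_congr h.eq_of_nhds
    (funext fun i => congrArg (fun L : EuclideanSpace ℝ (Fin n) →L[ℝ] EuclideanSpace ℝ (Fin n) =>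
      L (v i)) (h.mfderiv_eq (I := 𝓡 n) (I' := 𝓡 n)))

theorem pullback_comp (η : DiffForm n p M) {f : N → M} {g : P → N}
    (hf : MDifferentiable (𝓡 n) (𝓡 n) f) (hg : MDifferentiable (𝓡 n) (𝓡 n) g) :
    η.pullback (f ∘ g) = (η.pullback f).pullback g := by
  funext x
  ext v
  simp only [pullback, ContinuousAlternatingMap.compContinuousLinearMap_apply,
    mfderiv_comp x (hf (g x)) (hg x)]
  rfl

/-- The expression of a pullback in charts. -/
theorem inChart_pullback [IsManifold (𝓡 n) ∞ M] [IsManifold (𝓡 n) ∞ N] (η : DiffForm n p M)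
    {f : N → M} (hf : ContMDiff (𝓡 n) (𝓡 n) ∞ f)
    {φ : OpenPartialHomeomorph M (EuclideanSpace ℝ (Fin n))}
    (hφ : φ ∈ atlas (EuclideanSpace ℝ (Fin n)) M)
    {ψ : OpenPartialHomeomorph N (EuclideanSpace ℝ (Fin n))}
    (hψ : ψ ∈ atlas (EuclideanSpace ℝ (Fin n)) N)
    {y : EuclideanSpace ℝ (Fin n)} (hy : y ∈ ψ.target) (hfy : f (ψ.symm y) ∈ φ.source) :
    (η.pullback f).inChart ψ y =
      (η.inChart φ ((φ ∘ f ∘ ψ.symm) y)).compContinuousLinearMap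
        (fderiv ℝ (φ ∘ f ∘ ψ.symm) y) := by
  have : IsManifold (𝓡 n) 1 M := .of_le (n := ∞) (by simp)
  have : IsManifold (𝓡 n) 1 N := .of_le (n := ∞) (by simp)
  have hF : MDifferentiableAt (𝓡 n) (𝓡 n) (φ ∘ f ∘ ψ.symm) y :=
    ((hf.contDiffAt_in_charts hφ hψ hy hfy).differentiableAt (by simp)).mdifferentiableAt
  have hφs : MDifferentiableAt (𝓡 n) (𝓡 n) φ.symm ((φ ∘ f ∘ ψ.symm) y) :=
    mdifferentiableAt_atlas_symm hφ (φ.map_source hfy)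
  have hψs : MDifferentiableAt (𝓡 n) (𝓡 n) ψ.symm y := mdifferentiableAt_atlas_symm hψ hy
  have hfs : MDifferentiableAt (𝓡 n) (𝓡 n) f (ψ.symm y) := hf.mdifferentiableAt (by simp)
  have hev : φ.symm ∘ (φ ∘ f ∘ ψ.symm) =ᶠ[𝓝 y] f ∘ ψ.symm := by
    have hc : ContinuousAt (f ∘ ψ.symm) y := hfs.continuousAt.comp hψs.continuousAt
    filter_upwards [hc (φ.open_source.mem_nhds hfy)] with z hz
    exact φ.left_inv hz
  -- Differentiating `φ.symm ∘ (φ ∘ f ∘ ψ.symm) = f ∘ ψ.symm`, valid near `y`, gives the identity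
  -- between the linear maps inserted on the two sides.
  have e := hev.mfderiv_eq (I := 𝓡 n) (I' := 𝓡 n)
  rw [mfderiv_comp y hφs hF, mfderiv_comp y hfs hψs, mfderiv_eq_fderiv] at e
  ext v
  exact η.apply_congr (φ.left_inv hfy).symm (funext fun i =>
    (congrArg (fun L : EuclideanSpace ℝ (Fin n) →L[ℝ] EuclideanSpace ℝ (Fin n) => L (v i)) e).symm)

theorem Smooth.contDiffAt {η : DiffForm n p M} (hη : η.Smooth)
    {φ : OpenPartialHomeomorph M (EuclideanSpace ℝ (Fin n))}
    (hφ : φ ∈ atlas (EuclideanSpace ℝ (Fin n)) M) {y : EuclideanSpace ℝ (Fin n)}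
    (hy : y ∈ φ.target) : ContDiffAt ℝ ∞ (η.inChart φ) y :=
  (hη φ hφ).contDiffAt (φ.open_target.mem_nhds hy)

/-! ### Smooth, closed, volume and symplectic forms under pullback; invariance. -/

section Smooth

variable [IsManifold (𝓡 n) ∞ M] [IsManifold (𝓡 n) ∞ N]

theorem eventually_inChart_pullback (η : DiffForm n p M)
    {f : N → M} (hf : ContMDiff (𝓡 n) (𝓡 n) ∞ f)
    {φ : OpenPartialHomeomorph M (EuclideanSpace ℝ (Fin n))}
    (hφ : φ ∈ atlas (EuclideanSpace ℝ (Fin n)) M)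
    {ψ : OpenPartialHomeomorph N (EuclideanSpace ℝ (Fin n))}
    (hψ : ψ ∈ atlas (EuclideanSpace ℝ (Fin n)) N)
    {y : EuclideanSpace ℝ (Fin n)} (hy : y ∈ ψ.target) (hfy : f (ψ.symm y) ∈ φ.source) :
    (η.pullback f).inChart ψ =ᶠ[𝓝 y] fun z =>
      (η.inChart φ ((φ ∘ f ∘ ψ.symm) z)).compContinuousLinearMap
        (fderiv ℝ (φ ∘ f ∘ ψ.symm) z) := by
  have hc : ContinuousAt (f ∘ ψ.symm) y :=
    hf.continuous.continuousAt.comp (ψ.symm.continuousAt hy)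
  filter_upwards [ψ.open_target.mem_nhds hy, hc (φ.open_source.mem_nhds hfy)] with z hz hfz
  exact η.inChart_pullback hf hφ hψ hz hfz

/-- In charts the pullback is built from the smooth coefficients of `η`, the local expression of `f`
and its derivative, which is still `C^∞`. -/
theorem Smooth.pullback {η : DiffForm n p M} (hη : η.Smooth) {f : N → M}
    (hf : ContMDiff (𝓡 n) (𝓡 n) ∞ f) : (η.pullback f).Smooth := by
  intro ψ hψ y hy
  have hφ := chart_mem_atlas (EuclideanSpace ℝ (Fin n)) (f (ψ.symm y))
  have hs := mem_chart_source (EuclideanSpace ℝ (Fin n)) (f (ψ.symm y))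
  have hF := hf.contDiffAt_in_charts hφ hψ hy hs
  refine (ContDiffAt.congr_of_eventuallyEq ?_
    (η.eventually_inChart_pullback hf hφ hψ hy hs)).contDiffWithinAt
  exact ((hη.contDiffAt hφ (OpenPartialHomeomorph.map_source _ hs)).comp y
    hF).continuousAlternatingMap_compContinuousLinearMap (hF.fderiv_right (by simp))

/-- The exterior derivative commutes with pullback under the local expression of `f`. The chart
formula is needed on a neighbourhood because it gets differentiated. -/
theorem Closed.pullback {η : DiffForm n p M} (hη : η.Closed) (hηs : η.Smooth) {f : N → M}
    (hf : ContMDiff (𝓡 n) (𝓡 n) ∞ f) : (η.pullback f).Closed := by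
  intro ψ hψ y hy
  have hφ := chart_mem_atlas (EuclideanSpace ℝ (Fin n)) (f (ψ.symm y))
  have hs := mem_chart_source (EuclideanSpace ℝ (Fin n)) (f (ψ.symm y))
  have hF := hf.contDiffAt_in_charts hφ hψ hy hs
  set φ := chartAt (EuclideanSpace ℝ (Fin n)) (f (ψ.symm y))
  have hd : DifferentiableAt ℝ (η.inChart φ) ((φ ∘ f ∘ ψ.symm) y) :=
    (hηs.contDiffAt hφ (φ.map_source hs)).differentiableAt (by simp)
  rw [(η.eventually_inChart_pullback hf hφ hψ hy hs).extDeriv_eq,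
    extDeriv_pullback hd hF (by simpa using WithTop.coe_le_coe.2 (le_top : (2 : ℕ∞) ≤ ⊤)),
    show extDeriv (η.inChart φ) ((φ ∘ f ∘ ψ.symm) y) = 0 from hη _ hφ _ (φ.map_source hs)]
  ext v
  simp

/-- Smooth forms which agree on a dense set are equal. -/
theorem Smooth.eq_of_eqOn_dense {α β : DiffForm n p M} (hα : α.Smooth) (hβ : β.Smooth)
    {D : Set M} (hD : Dense D) (h : ∀ x ∈ D, α x = β x) : α = β := by
  have : IsManifold (𝓡 n) 1 M := .of_le (n := ∞) (by simp)
  funext x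
  have hψ := chart_mem_atlas (EuclideanSpace ℝ (Fin n)) x
  have hs := mem_chart_source (EuclideanSpace ℝ (Fin n)) x
  set ψ := chartAt (EuclideanSpace ℝ (Fin n)) x
  have hcα : ContinuousAt (α.inChart ψ ∘ ψ) x :=
    (hα.contDiffAt hψ (ψ.map_source hs)).continuousAt.comp (ψ.continuousAt hs)
  have hcβ : ContinuousAt (β.inChart ψ ∘ ψ) x :=
    (hβ.contDiffAt hψ (ψ.map_source hs)).continuousAt.comp (ψ.continuousAt hs)
  -- The forms are compared through their chart expressions, which take values in one fixed normed
  -- space, so that limits are unique.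
  have hfr : ∃ᶠ z in 𝓝 x, (α.inChart ψ ∘ ψ) z = (β.inChart ψ ∘ ψ) z := by
    refine ((mem_closure_iff_frequently.1 (hD x)).and_eventually
      (ψ.open_source.mem_nhds hs)).mono fun z hz => ?_
    have e : α (ψ.symm (ψ z)) = β (ψ.symm (ψ z)) := h _ (by rw [ψ.left_inv hz.2]; exact hz.1)
    simp only [Function.comp_apply, inChart, e]
  have e := tendsto_nhds_unique_of_frequently_eq hcα hcβ hfr
  -- The differential of `ψ.symm ∘ ψ` is the identity, so the form at `x` is recovered from its
  -- chart expression.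
  have hd := (mdifferentiable_of_mem_atlas (I := 𝓡 n) hψ).symm_comp_deriv hs
  have key : ∀ (γ : DiffForm n p M) (v : Fin p → EuclideanSpace ℝ (Fin n)),
      (γ x : EuclideanSpace ℝ (Fin n) [⋀^Fin p]→L[ℝ] ℝ) v =
        γ.inChart ψ (ψ x) (fun i =>
          (mfderiv (𝓡 n) (𝓡 n) ψ x : EuclideanSpace ℝ (Fin n) →L[ℝ] EuclideanSpace ℝ (Fin n))
            (v i)) := fun γ v =>
    γ.apply_congr (ψ.left_inv hs).symm (funext fun i => (congrArg
      (fun L : EuclideanSpace ℝ (Fin n) →L[ℝ] EuclideanSpace ℝ (Fin n) => L (v i)) hd).symm)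
  ext v
  refine (key α v).trans (Eq.trans ?_ (key β v).symm)
  exact congrArg (fun A : EuclideanSpace ℝ (Fin n) [⋀^Fin p]→L[ℝ] ℝ => A _) e

/-- Were the pullback zero at `x`, evaluating it on the preimages of arbitrary vectors under the
invertible differential would make `η` zero at `f x`. -/
theorem IsVolumeForm.pullback {η : DiffForm n n M} (hη : η.IsVolumeForm)
    (f : N ≃ₘ^∞⟮𝓡 n, 𝓡 n⟯ M) : (η.pullback f).IsVolumeForm := by
  refine ⟨hη.1.pullback f.contMDiff, fun x hx => hη.2 (f x) ?_⟩
  let A := f.mfderivToContinuousLinearEquiv (by simp) x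
  ext v
  have h := congrArg (fun B : TangentSpace (𝓡 n) x [⋀^Fin n]→L[ℝ] ℝ => B fun i => A.symm (v i)) hx
  have hA : (fun i => A (A.symm (v i))) = v := funext fun i => A.apply_symm_apply (v i)
  rw [← hA]
  exact h

/-- For nondegeneracy, testing `v` against `A.symm w` shows that `A v` is in the kernel of `η` at `f
x`, where `A` is the differential of `f`. -/
theorem IsSymplecticForm.pullback {η : DiffForm n 2 M} (hη : η.IsSymplecticForm)
    (f : N ≃ₘ^∞⟮𝓡 n, 𝓡 n⟯ M) : (η.pullback f).IsSymplecticForm := by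
  refine ⟨hη.1.pullback f.contMDiff, hη.2.1.pullback hη.1 f.contMDiff, fun x v hv => ?_⟩
  let A := f.mfderivToContinuousLinearEquiv (by simp) x
  refine A.injective ((hη.2.2 (f x) (A v) fun w => ?_).trans (map_zero A).symm)
  have h := hv (A.symm w)
  have hA : ![A v, w] = fun i => A (![v, A.symm w] i) := by
    funext i
    fin_cases i
    · rfl
    · exact (A.apply_symm_apply w).symm
  rw [hA]
  exact h

/-- At a point where `f ∘ g'` and `g ∘ f` agree as germs, functoriality turns the pullback by `g'`
of the pullback of `η` into the pullback by `f` of `g`-invariant `η`. Density of such points and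
smoothness do the rest. -/
theorem PreservedBy.pullback {G G' : Type*} [Group G] [Countable G]
    [Group G'] [MulAction G M] [MulAction G' N] [CompactSpace M] [T2Space M]
    (hG : ActsByDiffeos n ∞ G M) (hG' : ActsByDiffeos n ∞ G' N) {η : DiffForm n p M}
    (hηs : η.Smooth) (hη : η.PreservedBy G) (f : N ≃ₘ^∞⟮𝓡 n, 𝓡 n⟯ M)
    (hf : MapsOrbitRelation G' G f) : (η.pullback f).PreservedBy G' := by
  intro g'
  have hfs := hηs.pullback f.contMDiff
  refine (hfs.pullback (hG' g')).eq_of_eqOn_dense hfs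
    (dense_iUnion_interior_coincidence
      (fun g => (hG' g).continuous) (fun g => (hG g).continuous) f.toHomeomorph hf g') ?_
  intro x hx
  obtain ⟨g, hg⟩ := Set.mem_iUnion.1 hx
  have hd := f.contMDiff.mdifferentiable (by simp)
  have hev : f ∘ (fun x : N => g' • x) =ᶠ[𝓝 x] (fun y : M => g • y) ∘ f := by
    filter_upwards [isOpen_interior.mem_nhds hg] with z hz
    exact (interior_subset hz : z ∈ {y : N | f.toHomeomorph (g' • y) = g • f.toHomeomorph y})
  rw [← η.pullback_comp hd ((hG' g').mdifferentiable (by simp)), η.pullback_congr hev,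
    η.pullback_comp ((hG g).mdifferentiable (by simp)) hd, hη g]

end Smooth

end DiffForm

end

theorem mainTheorem8 {n : ℕ} {Γ Γ' M N : Type*} [Group Γ] [Countable Γ] [Group Γ']
    [TopologicalSpace M] [ChartedSpace (EuclideanSpace ℝ (Fin n)) M] [IsManifold (𝓡 n) ∞ M]
    [CompactSpace M] [T2Space M]
    [TopologicalSpace N] [ChartedSpace (EuclideanSpace ℝ (Fin n)) N] [IsManifold (𝓡 n) ∞ N]
    [MulAction Γ M] [MulAction Γ' N]
    (k : ℕ) {V : Type*} [TopologicalSpace V] [T2Space V] [MulAction (JetGroup n k) V] :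
    (∀ (hΓ : ActsByDiffeos n k Γ M) (hΓ' : ActsByDiffeos n k Γ' N)
      (η : GeometricStructure n k M V), η.PreservedBy hΓ →
      ∀ f : N ≃ₘ^k⟮𝓡 n, 𝓡 n⟯ M, MapsOrbitRelation Γ' Γ f →
        ∃ η' : GeometricStructure n k N V,
          (∀ p, η'.toFun p = η.toFun (FrameBundle.map f f.isLocalDiffeomorph p)) ∧
          η'.PreservedBy hΓ') ∧
    (ActsByDiffeos n ∞ Γ M → ActsByDiffeos n ∞ Γ' N →
      ∀ f : N ≃ₘ^∞⟮𝓡 n, 𝓡 n⟯ M, MapsOrbitRelation Γ' Γ f →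
        (∀ η : DiffForm n n M, η.IsVolumeForm → η.PreservedBy Γ →
          (η.pullback f).IsVolumeForm ∧ (η.pullback f).PreservedBy Γ') ∧
        (∀ η : DiffForm n 2 M, η.IsSymplecticForm → η.PreservedBy Γ →
          (η.pullback f).IsSymplecticForm ∧ (η.pullback f).PreservedBy Γ')) := by
  constructor
  · intro hΓ hΓ' η hη f hf
    have : IsManifold (𝓡 n) k M := .of_le (n := ∞) (by exact_mod_cast le_top)
    have : IsManifold (𝓡 n) k N := .of_le (n := ∞) (by exact_mod_cast le_top)
    exact ⟨η.pullback f f.isLocalDiffeomorph, fun _ => rfl, hη.pullback hΓ' f hf⟩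
  · intro hΓ hΓ' f hf
    exact ⟨fun η hη hp => ⟨hη.pullback f, hp.pullback hΓ hΓ' hη.1 f hf⟩,
      fun η hη hp => ⟨hη.pullback f, hp.pullback hΓ hΓ' hη.1 f hf⟩⟩
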